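/- Let $\chi$ be the primitive Dirichlet character modulo $3$, i.e. $\chi(n)=1$ if $n\equiv 1\pmod 3$, $\chi(n)=-1$ if $n\equiv 2\pmod 3$, and $\chi(n)=0$ if $n\equiv 0\pmod 3$. Let $\alpha,\beta>0$ be real numbers with $\alpha\beta=(\pi/3)^2$. Then both of the following series converge absolutely, and $$\sum_{n=1}^{\infty}\frac{(-1)^n\chi(n)}{n\left(2\cosh(n\alpha)-(-1)^n\right)}+\sum_{n=1}^{\infty}\frac{(-1)^n\chi(n)}{n\left(2\cosh(n\beta)-(-1)^n\right)}=-\frac{\pi}{3\sqrt3}.$$ In particular (taking $\alpha=\beta=\pi/3$), $$\sum_{n=1}^{\infty}\frac{(-1)^n\chi(n)}{n\left(2\cosh(n\pi/3)-(-1)^n\right)}=-\frac{\pi}{6\sqrt3}.$$ -/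

import Mathlib

/-- The primitive Dirichlet character modulo `3`: `χ(n)` is `0`, `1`, `-1` according as
`n` is congruent to `0`, `1`, `2` modulo `3`. -/
def chi3 : DirichletCharacter ℝ 3 where
  toFun := fun a => if a = 0 then 0 else if a = 1 then 1 else -1
  map_one' := by
    rw [if_neg (by decide), if_pos rfl]
  map_mul' := by
    have key : ∀ a b : ZMod 3, (if a * b = 0 then (0 : ℤ) else if a * b = 1 then 1 else -1) =
        (if a = 0 then 0 else if a = 1 then 1 else -1) *
          (if b = 0 then 0 else if b = 1 then 1 else -1) := by decide
    intro a b
    exact_mod_cast congrArg (Int.cast : ℤ → ℝ) (key a b)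
  map_nonunit' := by
    intro a ha
    by_cases h : a = 0
    · exact if_pos h
    · exact absurd ((isUnit_iff_ne_zero (a := a)).2 h) ha

theorem chi3_apply (a : ZMod 3) :
    chi3 a = if a = 0 then 0 else if a = 1 then 1 else -1 := rfl

theorem chi3_of_mod_eq_zero (n : ℕ) (h : n % 3 = 0) : chi3 n = 0 := by
  have e : (n : ZMod 3) = 0 := (ZMod.natCast_eq_natCast_iff' n 0 3).2 h
  rw [e, chi3_apply, if_pos rfl]

theorem chi3_of_mod_eq_one (n : ℕ) (h : n % 3 = 1) : chi3 n = 1 := by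
  have e : (n : ZMod 3) = ((1 : ℕ) : ZMod 3) := (ZMod.natCast_eq_natCast_iff' n 1 3).2 h
  rw [e, chi3_apply, if_neg (by decide), if_pos (by decide)]

theorem chi3_of_mod_eq_two (n : ℕ) (h : n % 3 = 2) : chi3 n = -1 := by
  have e : (n : ZMod 3) = ((2 : ℕ) : ZMod 3) := (ZMod.natCast_eq_natCast_iff' n 2 3).2 h
  rw [e, chi3_apply, if_neg (by decide), if_neg (by decide)]

theorem chi3_isPrimitive : chi3.IsPrimitive := by
  have hd : chi3.conductor ∣ 3 := DirichletCharacter.conductor_dvd_level chi3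
  rcases (Nat.dvd_prime Nat.prime_three).1 hd with h | h
  · exfalso
    have h1 : chi3 = 1 := (DirichletCharacter.eq_one_iff_conductor_eq_one).2 h
    have h2 : chi3 ((2 : ℕ) : ZMod 3) = -1 := chi3_of_mod_eq_two 2 rfl
    rw [h1, MulChar.one_apply (by decide)] at h2
    norm_num at h2
  · exact h

/-- The `n`-th term (`n ≥ 1`) of the series
`∑ (-1)^n χ(n) / (n (2 cosh (n α) - (-1)^n))`. -/
noncomputable def coshTerm (α : ℝ) (n : ℕ) : ℝ :=
  (-1) ^ n * chi3 n / (n * (2 * Real.cosh (n * α) - (-1) ^ n))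

/-! Put `t = 3α/π`. The partial fractions of the cotangent expand `1/(2 cosh(nα) ∓ 1)` as a constant
times the sum of `±j/(n²t² + j²)`, over `j ≡ ±1` mod 6 for even `n` and `j ≡ ±2` for odd `n`. Each
cosh series thus becomes a double series of `±j/(n(n²t² + j²))`. The condition on `αβ` says that `β`
corresponds to `1/t`, and after exchanging `n` and `j` in its series the terms combine by `j/(n(n²t²
+ j²)) + n/(j(j²t⁻² + n²)) = 1/(nj)`. So `t` disappears and the total factors into single series,
which are the same expansions at `y = 0` (`doubleBlock_add_swap`). The inner series converge only
conditionally. Pairing `q` with `6 - q` in each block makes the double series absolutely summable,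
which justifies the exchange (`summable_doubleBlock`). -/

open Filter Topology

/-! ### Partial fractions from the cotangent -/

/-- The rational kernel `u / (y² + u²)` of the partial fraction expansion of `1 / cosh`. -/
noncomputable def poleKernel (y u : ℝ) : ℝ := u / (y ^ 2 + u ^ 2)

theorem one_div_sub_one_div_eq_poleKernel (y : ℝ) {u : ℝ} (hu : u ≠ 0) :
    1 / (Complex.I * y - u) - 1 / (Complex.I * y + u) = -2 * (poleKernel y u : ℂ) := by
  have h1 : (Complex.I * y - u : ℂ) ≠ 0 := by
    intro h
    have := congrArg Complex.re h
    simp at this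
    exact hu this
  have h2 : (Complex.I * y + u : ℂ) ≠ 0 := by
    intro h
    have := congrArg Complex.re h
    simp at this
    exact hu this
  have h3 : (y ^ 2 + u ^ 2 : ℂ) ≠ 0 := by
    have : (y ^ 2 + u ^ 2 : ℝ) ≠ 0 := by positivity
    exact_mod_cast this
  rw [poleKernel]
  push_cast
  field_simp
  linear_combination (2 * (u : ℂ) * y ^ 2) * Complex.I_sq

/-- One kernel decays only like `1/u`; in the difference, `v - u` times `1/(y² + u²)` splits off and
the cofactor lies in `[-1, 1]`. -/
theorem abs_poleKernel_sub_le {y u v : ℝ} (hu : 0 < u) (huv : u ≤ v) :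
    |poleKernel y u - poleKernel y v| ≤ (v - u) / (y ^ 2 + u ^ 2) := by
  have hv : 0 < v := hu.trans_le huv
  have h1 : 0 < y ^ 2 + u ^ 2 := by positivity
  have h2 : 0 < y ^ 2 + v ^ 2 := by positivity
  have e : poleKernel y u - poleKernel y v =
      (v - u) / (y ^ 2 + u ^ 2) * ((u * v - y ^ 2) / (y ^ 2 + v ^ 2)) := by
    rw [poleKernel, poleKernel]
    field_simp
    ring
  have h3 : |(u * v - y ^ 2) / (y ^ 2 + v ^ 2)| ≤ 1 := by
    rw [abs_div, abs_of_pos h2, div_le_one h2, abs_le]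
    constructor <;> nlinarith [mul_pos hu hv, sq_nonneg y]
  have h4 : 0 ≤ (v - u) / (y ^ 2 + u ^ 2) := div_nonneg (by linarith) h1.le
  rw [e, abs_mul, abs_of_nonneg h4]
  exact mul_le_of_le_one_right h4 h3

/-- The poles pair up as `±(k + p)` and `±(k + 1 - p)`; symmetric truncation leaves the single
unmatched pair `±(N + p)`, whose contribution tends to 0. -/
theorem sum_cotTerm_sub_eq (y : ℝ) {p : ℝ} (h0 : 0 < p) (h1 : p < 1) (N : ℕ) :
    1 / (Complex.I * y - p) - 1 / (Complex.I * y + p) +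
      (∑ j ∈ Finset.range N, cotTerm (Complex.I * y - p) j -
        ∑ j ∈ Finset.range N, cotTerm (Complex.I * y + p) j) =
    -2 * ((∑ k ∈ Finset.range N, (poleKernel y (k + p) - poleKernel y (k + 1 - p)) +
      poleKernel y (N + p) : ℝ) : ℂ) := by
  induction N with
  | zero => simpa using one_div_sub_one_div_eq_poleKernel y h0.ne'
  | succ N ih =>
    have hN : (0 : ℝ) ≤ N := N.cast_nonneg
    have e1 := one_div_sub_one_div_eq_poleKernel y (u := N + 1 + p) (by positivity)
    have e2 := one_div_sub_one_div_eq_poleKernel y (u := N + 1 - p) (by linarith)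
    rw [Finset.sum_range_succ, Finset.sum_range_succ, Finset.sum_range_succ, cotTerm, cotTerm]
    push_cast at ih e1 e2 ⊢
    rw [show (Complex.I * y - p - (N + 1) : ℂ) = Complex.I * y - (N + 1 + p) by ring,
      show (Complex.I * y - p + (N + 1) : ℂ) = Complex.I * y + (N + 1 - p) by ring,
      show (Complex.I * y + p - (N + 1) : ℂ) = Complex.I * y - (N + 1 - p) by ring,
      show (Complex.I * y + p + (N + 1) : ℂ) = Complex.I * y + (N + 1 + p) by ring]
    linear_combination ih + e1 - e2

theorem mem_integerComplement_of_re {z : ℂ} {p : ℝ} (hz : |z.re| = p) (h0 : 0 < p) (h1 : p < 1) :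
    z ∈ Complex.integerComplement := by
  rintro ⟨n, rfl⟩
  simp only [Complex.intCast_re] at hz
  rw [← hz] at h0 h1
  norm_cast at h0 h1
  omega

/-- `cot a - cot b = sin(b - a)/(sin a sin b)`, where `b - a = 2πp` and `b + a = 2πiy`;
product-to-sum gives the denominator. -/
theorem cot_sub_cot_eq (y : ℝ) {p : ℝ} (h0 : 0 < p) (h1 : p < 1) :
    Complex.cot (Real.pi * (Complex.I * y - p)) - Complex.cot (Real.pi * (Complex.I * y + p)) =
      ((-2 * Real.sin (2 * Real.pi * p) /
        (Real.cosh (2 * Real.pi * y) - Real.cos (2 * Real.pi * p)) : ℝ) : ℂ) := by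
  have m1 := sin_pi_mul_ne_zero (mem_integerComplement_of_re (z := Complex.I * y - p)
    (by simp [abs_of_pos h0]) h0 h1)
  have m2 := sin_pi_mul_ne_zero (mem_integerComplement_of_re (z := Complex.I * y + p)
    (by simp [abs_of_pos h0]) h0 h1)
  set a : ℂ := Real.pi * (Complex.I * y - p) with ha
  set b : ℂ := Real.pi * (Complex.I * y + p) with hb
  have e1 : (Real.sin (2 * Real.pi * p) : ℂ) = Complex.sin (b - a) := by
    rw [Complex.ofReal_sin, ha, hb]
    push_cast
    ring_nf
  have e2 : (Real.cos (2 * Real.pi * p) : ℂ) = Complex.cos (b - a) := by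
    rw [Complex.ofReal_cos, ha, hb]
    push_cast
    ring_nf
  have e3 : (Real.cosh (2 * Real.pi * y) : ℂ) = Complex.cos (b + a) := by
    rw [Complex.ofReal_cosh, ← Complex.cos_mul_I, ha, hb]
    push_cast
    ring_nf
  have e4 : Complex.cos (b + a) - Complex.cos (b - a) = -2 * (Complex.sin a * Complex.sin b) := by
    rw [Complex.cos_add, Complex.cos_sub]
    ring
  rw [Complex.ofReal_div, Complex.ofReal_mul, Complex.ofReal_sub]
  rw [e1, e2, e3, e4, Complex.sin_sub, Complex.cot, Complex.cot]
  push_cast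
  field_simp

theorem tendsto_poleKernel_atTop (y p : ℝ) :
    Tendsto (fun N : ℕ => poleKernel y (N + p)) atTop (𝓝 0) := by
  have h1 : Tendsto (fun N : ℕ => (N : ℝ) + p) atTop atTop :=
    tendsto_atTop_add_const_right _ _ tendsto_natCast_atTop_atTop
  have h2 : Tendsto (fun u : ℝ => u⁻¹) atTop (𝓝 0) := tendsto_inv_atTop_zero
  refine squeeze_zero' ?_ ?_ (h2.comp h1)
  · filter_upwards [h1.eventually_gt_atTop 0] with N hN
    unfold poleKernel
    positivity
  · filter_upwards [h1.eventually_gt_atTop 0] with N hN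
    simp only [poleKernel, Function.comp]
    rw [inv_eq_one_div, div_le_div_iff₀ (by positivity) hN]
    nlinarith [sq_nonneg y]

/-- The partial fraction expansion of `sin (2πp) / (cosh (2πy) - cos (2πp))`. -/
theorem tendsto_sum_poleKernel_sub (y : ℝ) {p : ℝ} (h0 : 0 < p) (h1 : p < 1) :
    Tendsto (fun N : ℕ => ∑ k ∈ Finset.range N, (poleKernel y (k + p) - poleKernel y (k + 1 - p)))
      atTop (𝓝 (Real.pi * Real.sin (2 * Real.pi * p) /
        (Real.cosh (2 * Real.pi * y) - Real.cos (2 * Real.pi * p)))) := by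
  have m1 := mem_integerComplement_of_re (z := Complex.I * y - p) (by simp [abs_of_pos h0]) h0 h1
  have m2 := mem_integerComplement_of_re (z := Complex.I * y + p) (by simp [abs_of_pos h0]) h0 h1
  have t := ((tendsto_logDeriv_euler_cot_sub m1).sub (tendsto_logDeriv_euler_cot_sub m2)).const_add
    (1 / (Complex.I * y - p) - 1 / (Complex.I * y + p))
  simp_rw [sum_cotTerm_sub_eq y h0 h1] at t
  have c := cot_sub_cot_eq y h0 h1
  set R := -2 * Real.sin (2 * Real.pi * p) /
        (Real.cosh (2 * Real.pi * y) - Real.cos (2 * Real.pi * p)) with hR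
  rw [show 1 / (Complex.I * y - p) - 1 / (Complex.I * y + p) +
      (Real.pi * Complex.cot (Real.pi * (Complex.I * y - p)) - 1 / (Complex.I * y - p) -
        (Real.pi * Complex.cot (Real.pi * (Complex.I * y + p)) - 1 / (Complex.I * y + p))) =
      ((Real.pi * R : ℝ) : ℂ) by push_cast; linear_combination (Real.pi : ℂ) * c] at t
  have t' := ((Complex.continuous_re.tendsto _).comp t).const_mul (-1 / 2)
  have t'' := t'.sub (tendsto_poleKernel_atTop y p)
  convert t'' using 1
  · funext N
    simp only [Function.comp, Complex.re_ofReal_mul, Complex.ofReal_re,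
      show ((-2 : ℂ)) = ((-2 : ℝ) : ℂ) by push_cast; rfl]
    ring
  · rw [Complex.ofReal_re, hR]
    ring_nf

/-! ### Paired residues modulo 6 -/

/-- The contribution of the residues `±q` modulo `6` in the `B`-th block to the sum of an odd
character against `poleKernel y`. -/
noncomputable def kernelBlock (y q : ℝ) (B : ℕ) : ℝ :=
  poleKernel y (6 * B + q) - poleKernel y (6 * B + 6 - q)

theorem abs_kernelBlock_le (y : ℝ) {q : ℝ} (h1 : 1 ≤ q) (h3 : q ≤ 3) (B : ℕ) :
    |kernelBlock y q B| ≤ 4 / (y ^ 2 + ((B : ℝ) + 1) ^ 2) := by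
  have hB : (0 : ℝ) ≤ B := B.cast_nonneg
  -- The gap is `6 - 2q ≤ 4`, nonnegative because `q ≤ 3`.
  refine (abs_poleKernel_sub_le (by linarith) (by linarith)).trans ?_
  gcongr
  · linarith
  · linarith

theorem summable_kernelBlock (y : ℝ) {q : ℝ} (h1 : 1 ≤ q) (h3 : q ≤ 3) :
    Summable (kernelBlock y q) := by
  have hs : Summable fun B : ℕ => 4 * (1 / ((B : ℝ) + 1) ^ 2) := by
    have := (summable_nat_add_iff 1).2 (Real.summable_one_div_nat_pow.2 one_lt_two)
    exact (by simpa using this : Summable fun B : ℕ => 1 / ((B : ℝ) + 1) ^ 2).mul_left 4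
  refine Summable.of_norm_bounded hs fun B => ?_
  rw [Real.norm_eq_abs, mul_one_div]
  refine (abs_kernelBlock_le y h1 h3 B).trans ?_
  gcongr
  nlinarith [sq_nonneg y]

theorem hasSum_kernelBlock (y : ℝ) {q : ℝ} (h1 : 1 ≤ q) (h3 : q ≤ 3) :
    HasSum (kernelBlock y q) (Real.pi / 6 * Real.sin (Real.pi * q / 3) /
      (Real.cosh (Real.pi * y / 3) - Real.cos (Real.pi * q / 3))) := by
  rw [(summable_kernelBlock y h1 h3).hasSum_iff_tendsto_nat]
  -- Dilation by 6 carries the poles `k + q/6` to `6k + q`.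
  have t := (tendsto_sum_poleKernel_sub (y / 6) (p := q / 6) (by linarith) (by linarith)).const_mul
    (1 / 6)
  have scale : ∀ u v : ℝ, v = 6 * u → poleKernel y v = 1 / 6 * poleKernel (y / 6) u := by
    rintro u _ rfl
    rw [poleKernel, poleKernel, show y ^ 2 + (6 * u) ^ 2 = 36 * ((y / 6) ^ 2 + u ^ 2) by ring,
      mul_div_mul_comm]
    norm_num
  convert t using 1
  · funext N
    rw [Finset.mul_sum]
    refine Finset.sum_congr rfl fun k _ => ?_
    rw [kernelBlock, mul_sub, scale (k + q / 6) _ (by ring), scale (k + 1 - q / 6) _ (by ring)]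
  · rw [show 2 * Real.pi * (q / 6) = Real.pi * q / 3 by ring,
      show 2 * Real.pi * (y / 6) = Real.pi * y / 3 by ring]
    ring_nf

theorem hasSum_kernelBlock_one (y : ℝ) :
    HasSum (kernelBlock y 1) (Real.pi * √3 / 6 / (2 * Real.cosh (Real.pi * y / 3) - 1)) := by
  have h := hasSum_kernelBlock y (q := 1) le_rfl (by norm_num)
  rw [mul_one, Real.sin_pi_div_three, Real.cos_pi_div_three] at h
  have hc := Real.one_le_cosh (Real.pi * y / 3)
  convert h using 1
  have : 2 * Real.cosh (Real.pi * y / 3) - 1 ≠ 0 := by linarith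
  have : Real.cosh (Real.pi * y / 3) - 1 / 2 ≠ 0 := by linarith
  rw [div_eq_div_iff (by assumption) (by assumption)]
  ring

theorem hasSum_kernelBlock_two (y : ℝ) :
    HasSum (kernelBlock y 2) (Real.pi * √3 / 6 / (2 * Real.cosh (Real.pi * y / 3) + 1)) := by
  have h := hasSum_kernelBlock y (q := 2) one_le_two (by norm_num)
  rw [show Real.pi * 2 / 3 = Real.pi - Real.pi / 3 by ring, Real.sin_pi_sub, Real.cos_pi_sub,
    Real.sin_pi_div_three, Real.cos_pi_div_three] at h
  have hc := Real.one_le_cosh (Real.pi * y / 3)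
  convert h using 1
  have : 2 * Real.cosh (Real.pi * y / 3) + 1 ≠ 0 := by linarith
  have : Real.cosh (Real.pi * y / 3) - -(1 / 2) ≠ 0 := by linarith
  rw [div_eq_div_iff (by assumption) (by assumption)]
  ring

/-! ### The double series and its reciprocity -/

/-- The `6 × 6` block of the double series `∑ χ(n) χ(j) j / (n (n² t² + j²))` formed by the
residues `n ≡ ±p` and `j ≡ ±q` modulo `6`. -/
noncomputable def doubleBlock (t p q : ℝ) (x : ℕ × ℕ) : ℝ :=
  kernelBlock ((6 * x.1 + p) * t) q x.2 / (6 * x.1 + p) -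
    kernelBlock ((6 * x.1 + 6 - p) * t) q x.2 / (6 * x.1 + 6 - p)

/-- Separates the variables: with the extra factor `1/n ≤ 1/a`, the majorant becomes a multiple of
`a^(-3/2) b^(-3/2)`, a product of summable terms. -/
theorem sqrt_mul_le_sq_add_sq {a b : ℝ} (ha : 0 ≤ a) (hb : 0 ≤ b) :
    √a * (√b * b) ≤ a ^ 2 + b ^ 2 := by
  obtain ⟨r, hr, rfl⟩ : ∃ r, 0 ≤ r ∧ a = r ^ 2 := ⟨√a, Real.sqrt_nonneg a, (Real.sq_sqrt ha).symm⟩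
  obtain ⟨s, hs, rfl⟩ : ∃ s, 0 ≤ s ∧ b = s ^ 2 := ⟨√b, Real.sqrt_nonneg b, (Real.sq_sqrt hb).symm⟩
  rw [Real.sqrt_sq hr, Real.sqrt_sq hs]
  have e : r * (s * s ^ 2) = (r * s) * s ^ 2 := by ring
  nlinarith [sq_nonneg (r - s), sq_nonneg (r * s - s ^ 2), sq_nonneg (r ^ 2 - s ^ 2),
    sq_nonneg (r * s - r ^ 2), sq_nonneg (r * s)]

theorem abs_kernelBlock_div_le {t q n : ℝ} (ht : 0 < t) (h1 : 1 ≤ q) (h3 : q ≤ 3) {A : ℕ}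
    (hn : (A : ℝ) + 1 ≤ n) (B : ℕ) :
    |kernelBlock (n * t) q B / n| ≤ 4 / min (t ^ 2) 1 *
      (1 / (√((A : ℝ) + 1) * (A + 1)) * (1 / (√((B : ℝ) + 1) * (B + 1)))) := by
  have ha : (0 : ℝ) < (A : ℝ) + 1 := by positivity
  have hb : (0 : ℝ) < (B : ℝ) + 1 := by positivity
  generalize hA : (A : ℝ) + 1 = a at *
  have hk := abs_kernelBlock_le (n * t) h1 h3 B
  generalize (B : ℝ) + 1 = b at *
  have hn0 : 0 < n := ha.trans_le hn
  set m := min (t ^ 2) 1 with hm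
  have hm0 : 0 < m := lt_min (by positivity) one_pos
  have hmt : m ≤ t ^ 2 := min_le_left _ _
  have hm1 : m ≤ 1 := min_le_right _ _
  have hsa : 0 < √a := Real.sqrt_pos.2 ha
  have hsb : 0 < √b := Real.sqrt_pos.2 hb
  have hlow : m * (√a * (√b * b)) ≤ (n * t) ^ 2 + b ^ 2 := by
    calc m * (√a * (√b * b)) ≤ m * (a ^ 2 + b ^ 2) := by
          gcongr; exact sqrt_mul_le_sq_add_sq ha.le hb.le
      _ = a ^ 2 * m + m * b ^ 2 := by ring
      _ ≤ n ^ 2 * t ^ 2 + 1 * b ^ 2 := by gcongr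
      _ = _ := by ring
  rw [abs_div, abs_of_pos hn0]
  calc |kernelBlock (n * t) q B| / n ≤ 4 / (m * (√a * (√b * b))) / a := by
        gcongr
        exact hk.trans (by gcongr)
    _ = _ := by field_simp

theorem summable_doubleBlock {t p q : ℝ} (ht : 0 < t) (hp1 : 1 ≤ p) (hp3 : p ≤ 3) (h1 : 1 ≤ q)
    (h3 : q ≤ 3) : Summable (doubleBlock t p q) := by
  have hs : Summable fun A : ℕ => 1 / (√((A : ℝ) + 1) * (A + 1)) := by
    have := (summable_nat_add_iff 1).2 (Real.summable_one_div_nat_rpow.2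
      (by norm_num : (1 : ℝ) < 1 / 2 + 1))
    refine this.congr fun A => ?_
    rw [Real.rpow_add (by positivity), Real.rpow_one, ← Real.sqrt_eq_rpow]
    push_cast
    rfl
  have hp := (hs.mul_of_nonneg hs (fun A => by positivity) (fun A => by positivity)).mul_left
    (4 / min (t ^ 2) 1)
  refine Summable.sub ?_ ?_ <;> refine Summable.of_norm_bounded hp fun x => ?_ <;>
    refine abs_kernelBlock_div_le ht h1 h3 ?_ x.2 <;>
    linarith [(Nat.cast_nonneg x.1 : (0 : ℝ) ≤ x.1)]

/-- The reciprocity identity for the four pairs `(n, j)` of the block, with signs; `poleKernel 0 n`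
is `1/n`. -/
theorem doubleBlock_add_swap {t p q : ℝ} (ht : 0 < t) (hp1 : 1 ≤ p) (hp3 : p ≤ 3) (h1 : 1 ≤ q)
    (h3 : q ≤ 3) (x : ℕ × ℕ) :
    doubleBlock t p q x + doubleBlock t⁻¹ q p x.swap =
      kernelBlock 0 p x.1 * kernelBlock 0 q x.2 := by
  obtain ⟨A, B⟩ := x
  have hA : (0 : ℝ) ≤ A := A.cast_nonneg
  have hB : (0 : ℝ) ≤ B := B.cast_nonneg
  have key : ∀ n j : ℝ, 0 < n → 0 < j →
      poleKernel (n * t) j / n + poleKernel (j * t⁻¹) n / j =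
        poleKernel 0 n * poleKernel 0 j := by
    intro n j hn hj
    have : 0 < n ^ 2 * t ^ 2 + j ^ 2 := by positivity
    simp only [poleKernel]
    field_simp
    ring
  have k1 := key (6 * A + p) (6 * B + q) (by linarith) (by linarith)
  have k2 := key (6 * A + p) (6 * B + 6 - q) (by linarith) (by linarith)
  have k3 := key (6 * A + 6 - p) (6 * B + q) (by linarith) (by linarith)
  have k4 := key (6 * A + 6 - p) (6 * B + 6 - q) (by linarith) (by linarith)
  simp only [doubleBlock, kernelBlock, Prod.swap, sub_div]
  linear_combination k1 - k2 - k3 + k4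

/-- Summing the double series over both orders gives the product of two single series. -/
theorem tsum_doubleBlock_add_tsum_doubleBlock {t p q u v : ℝ} (ht : 0 < t) (hp1 : 1 ≤ p)
    (hp3 : p ≤ 3) (h1 : 1 ≤ q) (h3 : q ≤ 3) (hu : HasSum (kernelBlock 0 p) u)
    (hv : HasSum (kernelBlock 0 q) v) :
    ∑' x, doubleBlock t p q x + ∑' x, doubleBlock t⁻¹ q p x = u * v := by
  have s1 := summable_doubleBlock ht hp1 hp3 h1 h3
  have s2 := summable_doubleBlock (inv_pos.2 ht) h1 h3 hp1 hp3
  have e : ∑' x, doubleBlock t⁻¹ q p x = ∑' x : ℕ × ℕ, doubleBlock t⁻¹ q p x.swap :=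
    ((Equiv.prodComm ℕ ℕ).tsum_eq _).symm
  have s2' : Summable fun x : ℕ × ℕ => doubleBlock t⁻¹ q p x.swap :=
    (Equiv.prodComm ℕ ℕ).summable_iff.2 s2
  rw [e, ← s1.tsum_add s2', ← hu.tsum_eq, ← hv.tsum_eq,
    tsum_mul_tsum_of_summable_norm hu.summable.norm hv.summable.norm]
  exact tsum_congr fun x => doubleBlock_add_swap ht hp1 hp3 h1 h3 x

/-! ### Back to the cosh series -/

theorem abs_coshTerm_le (α : ℝ) (n : ℕ) :
    |coshTerm α n| ≤ 2 * Real.exp (-α) ^ n := by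
  rcases n.eq_zero_or_pos with rfl | hn
  · simp [coshTerm]
  have hc := Real.one_le_cosh (n * α)
  have he : Real.exp (n * α) / 2 ≤ Real.cosh (n * α) := by
    rw [Real.cosh_eq]
    linarith [Real.exp_pos (-(n * α))]
  have hn1 : (1 : ℝ) ≤ n := by exact_mod_cast hn
  have hs : (-1 : ℝ) ^ n ≤ 1 := by
    rcases neg_one_pow_eq_or ℝ n with h | h <;> rw [h]
    norm_num
  have hd : Real.exp (n * α) / 2 ≤ n * (2 * Real.cosh (n * α) - (-1) ^ n) := by nlinarith
  have hchi : |chi3 n| ≤ 1 := by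
    rw [chi3_apply]
    split_ifs <;> norm_num
  have hpos := Real.exp_pos (n * α)
  rw [coshTerm, abs_div, abs_mul, abs_pow, abs_neg, abs_one, one_pow, one_mul,
    abs_of_pos (a := (n : ℝ) * _) (by linarith)]
  calc _ ≤ 1 / (Real.exp (n * α) / 2) := by gcongr
    _ = _ := by
      rw [← Real.exp_nat_mul, mul_neg, Real.exp_neg]
      field_simp

theorem summable_coshTerm {α : ℝ} (hα : 0 < α) : Summable (coshTerm α) :=
  Summable.of_norm_bounded ((summable_geometric_of_lt_one (Real.exp_pos _).le
    (Real.exp_lt_one_iff.2 (neg_lt_zero.2 hα))).mul_left 2) fun n => abs_coshTerm_le α n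

theorem hasSum_doubleBlock_right {α : ℝ} {q : ℝ} {f : ℝ → ℝ} (p : ℝ) (A : ℕ)
    (hf : ∀ y, HasSum (kernelBlock y q) (f (Real.pi * y / 3))) :
    HasSum (fun B => doubleBlock (3 * α / Real.pi) p q (A, B))
      (f ((6 * A + p) * α) / (6 * A + p) - f ((6 * A + 6 - p) * α) / (6 * A + 6 - p)) := by
  have e : ∀ n : ℝ, Real.pi * (n * (3 * α / Real.pi)) / 3 = n * α := fun n => by
    field_simp
  have h1 := (hf ((6 * A + p) * (3 * α / Real.pi))).div_const (6 * A + p)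
  have h2 := (hf ((6 * A + 6 - p) * (3 * α / Real.pi))).div_const (6 * A + 6 - p)
  rw [e] at h1 h2
  exact h1.sub h2

/-- Modulo 6, `(-1)^n χ(n)` is `-1` at 1, 2, `+1` at 4, 5, and 0 otherwise. The parity of `n` fixes
the sign in the denominator, so `p = 1` goes with `q = 2` and `p = 2` with `q = 1`. -/
theorem tsum_coshTerm_eq {α : ℝ} (hα : 0 < α) :
    ∑' n, coshTerm α n = -(6 / (Real.pi * √3)) *
      (∑' x, doubleBlock (3 * α / Real.pi) 2 1 x + ∑' x, doubleBlock (3 * α / Real.pi) 1 2 x) := by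
  have ht : 0 < 3 * α / Real.pi := by positivity
  have s21 := summable_doubleBlock ht one_le_two (by norm_num) le_rfl (by norm_num : (1 : ℝ) ≤ 3)
  have s12 := summable_doubleBlock ht le_rfl (by norm_num : (1 : ℝ) ≤ 3) one_le_two (by norm_num)
  have H := (s21.hasSum.add s12.hasSum).prod_fiberwise fun A =>
    (hasSum_doubleBlock_right (α := α) (f := fun x => Real.pi * √3 / 6 / (2 * Real.cosh x - 1)) 2 A
      hasSum_kernelBlock_one).add
      (hasSum_doubleBlock_right (α := α) (f := fun x => Real.pi * √3 / 6 / (2 * Real.cosh x + 1)) 1 A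
        hasSum_kernelBlock_two)
  have hs := summable_coshTerm hα
  have hs' : Summable fun x : ℕ × Fin 6 => coshTerm α (x.1 * 6 + x.2) :=
    ((Nat.divModEquiv 6).symm.summable_iff (f := coshTerm α)).2 hs
  have e : ∑' n, coshTerm α n = ∑' A : ℕ, ∑ r : Fin 6, coshTerm α (A * 6 + r) := by
    rw [← (Nat.divModEquiv 6).symm.tsum_eq (coshTerm α)]
    exact (hs'.tsum_prod).trans (tsum_congr fun A => tsum_fintype _)
  rw [e, ← H.tsum_eq, ← tsum_mul_left]
  refine tsum_congr fun A => ?_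
  have c0 : chi3 ((A * 6 : ℕ) : ZMod 3) = 0 := chi3_of_mod_eq_zero _ (by omega)
  have c1 : chi3 ((A * 6 + 1 : ℕ) : ZMod 3) = 1 := chi3_of_mod_eq_one _ (by omega)
  have c2 : chi3 ((A * 6 + 2 : ℕ) : ZMod 3) = -1 := chi3_of_mod_eq_two _ (by omega)
  have c3 : chi3 ((A * 6 + 3 : ℕ) : ZMod 3) = 0 := chi3_of_mod_eq_zero _ (by omega)
  have c4 : chi3 ((A * 6 + 4 : ℕ) : ZMod 3) = 1 := chi3_of_mod_eq_one _ (by omega)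
  have c5 : chi3 ((A * 6 + 5 : ℕ) : ZMod 3) = -1 := chi3_of_mod_eq_two _ (by omega)
  have p0 : (-1 : ℝ) ^ (A * 6) = 1 := by rw [mul_comm, pow_mul]; norm_num
  have f0 : coshTerm α (A * 6) = 0 := by rw [coshTerm, c0]; simp
  have f3 : coshTerm α (A * 6 + 3) = 0 := by rw [coshTerm, c3]; simp
  have f1 : coshTerm α (A * 6 + 1) =
      -1 / ((6 * A + 1) * (2 * Real.cosh ((6 * A + 1) * α) + 1)) := by
    rw [coshTerm, c1, pow_add, p0]; push_cast; ring_nf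
  have f2 : coshTerm α (A * 6 + 2) =
      -1 / ((6 * A + 2) * (2 * Real.cosh ((6 * A + 2) * α) - 1)) := by
    rw [coshTerm, c2, pow_add, p0]; push_cast; ring_nf
  have f4 : coshTerm α (A * 6 + 4) =
      1 / ((6 * A + 6 - 2) * (2 * Real.cosh ((6 * A + 6 - 2) * α) - 1)) := by
    rw [coshTerm, c4, pow_add, p0]; push_cast; ring_nf
  have f5 : coshTerm α (A * 6 + 5) =
      1 / ((6 * A + 6 - 1) * (2 * Real.cosh ((6 * A + 6 - 1) * α) + 1)) := by
    rw [coshTerm, c5, pow_add, p0]; push_cast; ring_nf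
  have g : ∀ n d : ℝ, Real.pi * √3 / 6 / d / n = Real.pi * √3 / 6 * (1 / (n * d)) := fun n d => by
    rw [div_div, mul_one_div, mul_comm n d]
  have k : 6 / (Real.pi * √3) * (Real.pi * √3 / 6) = 1 := by field_simp
  simp only [Fin.sum_univ_six, Fin.coe_ofNat_eq_mod]
  norm_num only
  rw [add_zero, f0, f1, f2, f3, f4, f5]
  simp only [g, neg_div]
  linear_combination (1 / ((6 * A + 6 - 2) * (2 * Real.cosh ((6 * A + 6 - 2) * α) - 1))
    + 1 / ((6 * A + 6 - 1) * (2 * Real.cosh ((6 * A + 6 - 1) * α) + 1))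
    - 1 / ((6 * A + 2) * (2 * Real.cosh ((6 * A + 2) * α) - 1))
    - 1 / ((6 * A + 1) * (2 * Real.cosh ((6 * A + 1) * α) + 1)) : ℝ) * -k

theorem tsum_coshTerm_add_tsum_coshTerm {α β : ℝ} (hα : 0 < α) (hβ : 0 < β)
    (h : α * β = (Real.pi / 3) ^ 2) :
    ∑' n, coshTerm α n + ∑' n, coshTerm β n = -(Real.pi / (3 * √3)) := by
  have ht : 0 < 3 * α / Real.pi := by positivity
  have hti : 3 * β / Real.pi = (3 * α / Real.pi)⁻¹ := by
    rw [inv_div, div_eq_div_iff (by positivity) (by positivity)]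
    linear_combination 9 * h
  have u1 := hasSum_kernelBlock_one 0
  have u2 := hasSum_kernelBlock_two 0
  have e1 := tsum_doubleBlock_add_tsum_doubleBlock ht one_le_two (by norm_num) le_rfl
    (by norm_num) u2 u1
  have e2 := tsum_doubleBlock_add_tsum_doubleBlock ht le_rfl (by norm_num) one_le_two
    (by norm_num) u1 u2
  rw [tsum_coshTerm_eq hα, tsum_coshTerm_eq hβ, hti]
  -- At `y = 0` the denominators are 1 and 3, so both products equal `π²/36`.
  rw [mul_zero, zero_div, Real.cosh_zero] at e1 e2
  have hs : √3 ^ 2 = 3 := Real.sq_sqrt (by norm_num)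
  rw [← mul_add, show ∀ a b c d : ℝ, a + b + (c + d) = a + d + (b + c) by intros; ring, e1, e2]
  field_simp
  rw [hs]
  norm_num

theorem mainTheorem12 :
    (∀ α β : ℝ, 0 < α → 0 < β → α * β = (Real.pi / 3) ^ 2 →
      Summable (fun n : ℕ => coshTerm α (n + 1)) ∧
      Summable (fun n : ℕ => coshTerm β (n + 1)) ∧
      (∑' n : ℕ, coshTerm α (n + 1)) + (∑' n : ℕ, coshTerm β (n + 1)) =
        -(Real.pi / (3 * Real.sqrt 3))) ∧
    HasSum (fun n : ℕ => coshTerm (Real.pi / 3) (n + 1)) (-(Real.pi / (6 * Real.sqrt 3))) := by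
  have hsum : ∀ {α : ℝ}, 0 < α → Summable fun n : ℕ => coshTerm α (n + 1) := fun hα =>
    (summable_nat_add_iff 1).2 (summable_coshTerm hα)
  have hshift : ∀ {α : ℝ}, 0 < α → ∑' n : ℕ, coshTerm α (n + 1) = ∑' n, coshTerm α n := by
    intro α hα
    -- The added term at `n = 0` vanishes.
    rw [(summable_coshTerm hα).tsum_eq_zero_add]
    simp [coshTerm]
  refine ⟨fun α β hα hβ h => ⟨hsum hα, hsum hβ, ?_⟩, ?_⟩
  · rw [hshift hα, hshift hβ, tsum_coshTerm_add_tsum_coshTerm hα hβ h]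
  · have hp : 0 < Real.pi / 3 := by positivity
    have h := tsum_coshTerm_add_tsum_coshTerm hp hp (sq _).symm
    rw [(hsum hp).hasSum_iff, hshift hp]
    rw [show Real.pi / (6 * √3) = Real.pi / (3 * √3) / 2 by field_simp; norm_num]
    linarith
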